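/- Let $d\ge 1$ and let $X\subset\mathbb R^d$ be a non-empty compact set with $\overline{\operatorname{int}X}=X$ such that $X$ is convex, or $\partial X$ is smooth, or $X$ satisfies the cone condition (there are a fixed opening angle and a fixed length such that every point of $\partial X$ is the vertex of an open cone of that angle and length contained in $\operatorname{int}X$). A non-autonomous conformal iterated function system $\Phi$ on $X$ is a sequence of families of maps $\Phi^{(j)}=(\phi^{(j)}_i:X\to X)_{i\in I^{(j)}}$, $j\ge1$, with non-empty countable index sets $I^{(j)}$, such that: (a) $\phi^{(j)}_i(\operatorname{int}X)\cap\phi^{(j)}_{i'}(\operatorname{int}X)=\emptyset$ for all $j$ and all $i\ne i'$ in $I^{(j)}$; (b) there is an open connected set $V\supset X$ such that every $\phi^{(j)}_i$ extends to a $C^1$ conformal diffeomorphism of $V$ into $V$ (the derivative at each point is an invertible similarity, whose scaling factor is denoted $|D\phi(x)|$); (c) there is $K\ge1$ such that every composition $\phi=\phi^{(k)}_{\omega_k}\circ\dots\circ\phi^{(l)}_{\omega_l}$ with $k\le l$, $\omega_j\in I^{(j)}$, satisfies $|D\phi(x)|\le K|D\phi(y)|$ for all $x,y\in V$; (d) there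 is $\eta<1$ such that, for all sufficiently large $m$, all $j\ge1$ and all $\omega_k\in I^{(k)}$, the composition $\phi=\phi^{(j)}_{\omega_j}\circ\dots\circ\phi^{(j+m)}_{\omega_{j+m}}$ satisfies $|D\phi(x)|\le\eta^m$ for all $x\in X$. Write $\|D\phi\|=\sup_{x\in X}|D\phi(x)|$, $I^n=\prod_{j=1}^nI^{(j)}$ and $\phi_\omega=\phi^{(1)}_{\omega_1}\circ\dots\circ\phi^{(n)}_{\omega_n}$ for $\omega\in I^n$. The limit set is $J(\Phi)=\bigcap_{n\ge1}\bigcup_{\omega\in I^n}\phi_\omega(X)$. For $t\ge0$ put $Z_n(t)=\sum_{\omega\in I^n}\|D\phi_\omega\|^t$ and $\underline P(t)=\liminf_{n\to\infty}\frac1n\log Z_n(t)\in[-\infty,\infty]$. The Bowen dimension is $B(\Phi)=\sup\{t\ge0:\underline P(t)>0\}$ (with $\sup\emptyset=0$), and $\operatorname{HD}$ denotes Hausdorff dimension. **Proposition.** Let $\Phi$ be a non-autonomous conformal iterated function system on $X$ all of whose index sets $I^{(n)}$ are finite. Suppose that the limit $a=\lim_{n\to\infty}\frac1n\log\#I^{(n)}$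 exists, and that the limit $b=\lim_{n\to\infty}\frac1n\log\bigl(1/\|D\phi^{(n)}_j\|\bigr)$ exists uniformly in $j\in I^{(n)}$, i.e. for every $\varepsilon>0$ there is $N$ such that $\bigl|\frac1n\log(1/\|D\phi^{(n)}_j\|)-b\bigr|<\varepsilon$ for all $n\ge N$ and all $j\in I^{(n)}$; suppose that $a$ and $b$ are finite and positive. Then $B(\Phi)=a/b=\operatorname{HD}(J(\Phi))$. -/

import Mathlib

open Filter Topology
open scoped NNReal ENNReal

universe u

/-- The boundary of `X` is smooth: near each of its points it is the zero set of a smooth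
function with nonvanishing derivative, i.e. it is an embedded smooth hypersurface. -/
def HasSmoothBoundary {d : ℕ} (X : Set (EuclideanSpace ℝ (Fin d))) : Prop :=
  ∀ p ∈ frontier X, ∃ U : Set (EuclideanSpace ℝ (Fin d)),
    ∃ g : EuclideanSpace ℝ (Fin d) → ℝ,
      IsOpen U ∧ p ∈ U ∧ ContDiffOn ℝ (⊤ : ℕ∞) g U ∧ fderiv ℝ g p ≠ 0 ∧
        frontier X ∩ U = {x ∈ U | g x = 0}

/-- The (interior) cone condition: there are an opening angle (with cosine `κ`) and a length `l`
such that every boundary point of `X` is the vertex of an open cone with that angle and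
that length contained in the interior of `X`. -/
def HasConeCondition {d : ℕ} (X : Set (EuclideanSpace ℝ (Fin d))) : Prop :=
  ∃ κ l : ℝ, 0 ≤ κ ∧ κ < 1 ∧ 0 < l ∧
    ∀ x ∈ frontier X, ∃ v : EuclideanSpace ℝ (Fin d), ‖v‖ = 1 ∧
      ∀ y : EuclideanSpace ℝ (Fin d),
        0 < ‖y - x‖ → ‖y - x‖ < l → κ * ‖y - x‖ < inner ℝ (y - x) v → y ∈ interior X

/-- The standing assumptions on the phase space `X ⊆ ℝ^d`. -/
structure IsPhaseSpace {d : ℕ} (X : Set (EuclideanSpace ℝ (Fin d))) : Prop where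
  nonempty : X.Nonempty
  isCompact : IsCompact X
  closure_interior : closure (interior X) = X
  geometry : Convex ℝ X ∨ HasSmoothBoundary X ∨ HasConeCondition X

/-- Words `ω_m ω_{m+1} … ω_{m+n-1}` of length `n` that start at level `m`. Levels are numbered
from `0`, so `I j` is the alphabet usually written `I^{(j+1)}`. -/
abbrev Word (I : ℕ → Type u) (m n : ℕ) : Type u := (k : Fin n) → I (m + k)

/-- The composition `φ_{ω_m} ∘ φ_{ω_{m+1}} ∘ … ∘ φ_{ω_{m+n-1}}` along a word `ω` of length `n`
starting at level `m` (the identity for the empty word). -/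
def wordMap {d : ℕ} {I : ℕ → Type u}
    (φ : (j : ℕ) → I j → EuclideanSpace ℝ (Fin d) → EuclideanSpace ℝ (Fin d)) (m : ℕ) :
    (n : ℕ) → Word I m n → EuclideanSpace ℝ (Fin d) → EuclideanSpace ℝ (Fin d)
  | 0, _ => id
  | n + 1, ω => wordMap φ m n (fun k => ω k.castSucc) ∘ φ (m + n) (ω (Fin.last n))

/-- A non-autonomous conformal iterated function system on `X`. Each map is given together with
its extension to the common domain `V ⊇ X`; values of `map j i` outside `V` are irrelevant.
`I j`, `map j` are the alphabet and the maps of the `(j+1)`-st system `Φ^{(j+1)}`.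
On `V` the operator norm `‖fderiv ℝ φ x‖` is the scaling factor of the similarity `Dφ(x)`. -/
structure NCIFS {d : ℕ} (X : Set (EuclideanSpace ℝ (Fin d))) where
  /-- the alphabets -/
  I : ℕ → Type u
  nonempty : ∀ j, Nonempty (I j)
  countable : ∀ j, Countable (I j)
  /-- the maps, extended to `V` -/
  map : (j : ℕ) → I j → EuclideanSpace ℝ (Fin d) → EuclideanSpace ℝ (Fin d)
  mapsTo : ∀ j i, Set.MapsTo (map j i) X X
  /-- open set condition -/
  open_set_condition : ∀ j (a b : I j), a ≠ b →
    Disjoint (map j a '' interior X) (map j b '' interior X)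
  /-- the common domain of the extended maps -/
  V : Set (EuclideanSpace ℝ (Fin d))
  isOpen_V : IsOpen V
  isConnected_V : IsConnected V
  subset_V : X ⊆ V
  /-- each map is a `C^1` conformal diffeomorphism of `V` into `V` (injective, `C^1`, and with
  derivative an invertible similarity everywhere) -/
  mapsTo_V : ∀ j i, Set.MapsTo (map j i) V V
  injOn_V : ∀ j i, Set.InjOn (map j i) V
  contDiffOn_V : ∀ j i, ContDiffOn ℝ 1 (map j i) V
  conformalAt_V : ∀ j i, ∀ x ∈ V, ConformalAt (map j i) x
  bounded_distortion : ∃ K : ℝ, 1 ≤ K ∧ ∀ (m n : ℕ) (ω : Word I m n), ∀ x ∈ V, ∀ y ∈ V,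
    ‖fderiv ℝ (wordMap map m n ω) x‖ ≤ K * ‖fderiv ℝ (wordMap map m n ω) y‖
  uniform_contraction : ∃ η : ℝ, η < 1 ∧ ∃ N : ℕ, ∀ n, N ≤ n → ∀ (m : ℕ) (ω : Word I m (n + 1)),
    ∀ x ∈ X, ‖fderiv ℝ (wordMap map m (n + 1) ω) x‖ ≤ η ^ n

/-- `‖Dφ‖ = sup_{x ∈ X} |Dφ(x)|`. -/
noncomputable def derivNorm {d : ℕ} (X : Set (EuclideanSpace ℝ (Fin d)))
    (φ : EuclideanSpace ℝ (Fin d) → EuclideanSpace ℝ (Fin d)) : ℝ :=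
  sSup ((fun x => ‖fderiv ℝ φ x‖) '' X)

namespace NCIFS

variable {d : ℕ} {X : Set (EuclideanSpace ℝ (Fin d))}

/-- `X_n`, the union of `φ_ω(X)` over all initial words `ω` of length `n`. -/
def levelSet (Φ : NCIFS.{u} X) (n : ℕ) : Set (EuclideanSpace ℝ (Fin d)) :=
  ⋃ ω : Word Φ.I 0 n, wordMap Φ.map 0 n ω '' X

/-- The limit set `J(Φ) = ⋂_{n ≥ 1} X_n`. -/
def limitSet (Φ : NCIFS.{u} X) : Set (EuclideanSpace ℝ (Fin d)) :=
  ⋂ (n : ℕ) (_ : 1 ≤ n), Φ.levelSet n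

/-- `Z_n(t) = ∑_{ω} ‖Dφ_ω‖^t`, the sum over all initial words of length `n`. -/
noncomputable def Z (Φ : NCIFS.{u} X) (n : ℕ) (t : ℝ≥0) : ℝ≥0∞ :=
  ∑' ω : Word Φ.I 0 n, ENNReal.ofReal (derivNorm X (wordMap Φ.map 0 n ω) ^ (t : ℝ))

/-- The lower pressure `liminf (1/n) log Z_n(t) ∈ [-∞, ∞]`. -/
noncomputable def lowerPressure (Φ : NCIFS.{u} X) (t : ℝ≥0) : EReal :=
  liminf (fun n : ℕ => ENNReal.log (Φ.Z n t) / (n : EReal)) atTop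

/-- The Bowen dimension `B(Φ)`: the supremum of all `t ≥ 0` with positive lower pressure
(zero if there are none). -/
noncomputable def bowenDim (Φ : NCIFS.{u} X) : ℝ≥0∞ :=
  ⨆ (t : ℝ≥0) (_ : 0 < Φ.lowerPressure t), (t : ℝ≥0∞)

end NCIFS

/-
The maps of level `n` have derivatives of size `exp (-(b + o(1)) n)`, so by conformality those of
the words of length `n` are of size `exp (-(b / 2 + o(1)) n²)`, while there are
`exp ((a / 2 + o(1)) n²)` such words. Multiplicative constants, bounded powers of the ratio
between the largest and the smallest word, and a shift of `n` by one only contribute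
`exp (o(n²))`, which is negligible against the gap between `a / 2` and `t * b / 2` for `t ≠ a / b`.

For the Bowen dimension this determines the sign of the pressure. The pieces `φ_ω(X)` cover the
limit set, which bounds its dimension from above. For the lower bound, push the uniform Bernoulli
measure forward to the limit set. Comparing volumes, a set of the diameter of a piece of level `n`
meets only `exp (o(n²))` of these pieces, so its mass is at most `exp ((-a / 2 + o(1)) n²)`. For
`t < a / b` this is below the `t`-th power of the size of the pieces of level `n + 1`, and the mass
distribution principle applies.
-/

section Conformal

variable {E F G : Type*} [NormedAddCommGroup E] [NormedSpace ℝ E] [NormedAddCommGroup F]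
  [NormedSpace ℝ F] [NormedAddCommGroup G] [NormedSpace ℝ G]

theorem norm_apply_of_isConformalMap {f : E →L[ℝ] F} (hf : IsConformalMap f) (v : E) :
    ‖f v‖ = ‖f‖ * ‖v‖ := by
  obtain ⟨c, -, li, rfl⟩ := hf
  rcases subsingleton_or_nontrivial E with _ | _
  · simp only [Subsingleton.elim v 0, map_zero, norm_zero, mul_zero]
  · simp [norm_smul, li.norm_toContinuousLinearMap]

theorem norm_comp_of_isConformalMap {g : F →L[ℝ] G} {f : E →L[ℝ] F} (hg : IsConformalMap g)
    (hf : IsConformalMap f) : ‖g.comp f‖ = ‖g‖ * ‖f‖ := by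
  rcases subsingleton_or_nontrivial E with _ | _
  · simp only [Subsingleton.elim f 0, ContinuousLinearMap.comp_zero, norm_zero, mul_zero]
  · obtain ⟨v, hv⟩ := exists_ne (0 : E)
    refine mul_right_cancel₀ (norm_ne_zero_iff.2 hv) ?_
    rw [← norm_apply_of_isConformalMap (hg.comp hf), ContinuousLinearMap.comp_apply,
      norm_apply_of_isConformalMap hg, norm_apply_of_isConformalMap hf, mul_assoc]

theorem norm_fderiv_comp_of_conformalAt {g : F → G} {f : E → F} {x : E}
    (hg : ConformalAt g (f x)) (hf : ConformalAt f x) :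
    ‖fderiv ℝ (g ∘ f) x‖ = ‖fderiv ℝ g (f x)‖ * ‖fderiv ℝ f x‖ := by
  rw [fderiv_comp x hg.differentiableAt hf.differentiableAt]
  exact norm_comp_of_isConformalMap (conformalAt_iff_isConformalMap_fderiv.1 hg)
    (conformalAt_iff_isConformalMap_fderiv.1 hf)

theorem norm_fderiv_pos_of_conformalAt [Nontrivial E] {f : E → F} {x : E}
    (hf : ConformalAt f x) : 0 < ‖fderiv ℝ f x‖ :=
  norm_pos_iff.2 (conformalAt_iff_isConformalMap_fderiv.1 hf).ne_zero

theorem range_eq_top_of_isConformalMap [FiniteDimensional ℝ E] {f : E →L[ℝ] E}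
    (hf : IsConformalMap f) : f.toLinearMap.range = ⊤ :=
  LinearMap.range_eq_top.2 (LinearMap.surjective_of_injective hf.injective)

end Conformal

section ConformalVolume

open MeasureTheory Module

variable {E : Type*} [NormedAddCommGroup E] [InnerProductSpace ℝ E] [FiniteDimensional ℝ E]

theorem abs_det_of_isConformalMap {f : E →L[ℝ] E} (hf : IsConformalMap f) :
    |f.det| = ‖f‖ ^ finrank ℝ E := by
  obtain ⟨c, -, li, rfl⟩ := hf
  rcases subsingleton_or_nontrivial E with _ | _
  · simp [ContinuousLinearMap.det, LinearMap.det_eq_one_of_subsingleton,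
      finrank_zero_of_subsingleton]
  · have hcoe : ((c • li.toContinuousLinearMap : E →L[ℝ] E) : E →ₗ[ℝ] E) =
        c • li.toLinearMap := rfl
    rw [norm_smul, li.norm_toContinuousLinearMap, mul_one, ContinuousLinearMap.det,
      ← Real.norm_eq_abs, ← LinearMap.normDet_eq_norm_det, hcoe, LinearMap.normDet_smul,
      li.normDet_eq_one, mul_one]

theorem ofReal_pow_mul_measure_le_measure_image [MeasurableSpace E] [BorelSpace E]
    (μ : Measure E) [μ.IsAddHaarMeasure] {f : E → E} {s : Set E} {c : ℝ} (hs : MeasurableSet s)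
    (hinj : s.InjOn f) (hf : ∀ x ∈ s, ConformalAt f x) (hc : 0 ≤ c)
    (hcf : ∀ x ∈ s, c ≤ ‖fderiv ℝ f x‖) :
    ENNReal.ofReal (c ^ finrank ℝ E) * μ s ≤ μ (f '' s) := by
  have hderiv : ∀ x ∈ s, HasFDerivWithinAt f (fderiv ℝ f x) s x := fun x hx =>
    (hf x hx).differentiableAt.hasFDerivAt.hasFDerivWithinAt
  calc ENNReal.ofReal (c ^ finrank ℝ E) * μ s
      = ∫⁻ _ in s, ENNReal.ofReal (c ^ finrank ℝ E) ∂μ := (setLIntegral_const _ _).symm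
    _ ≤ ∫⁻ x in s, ENNReal.ofReal |(fderiv ℝ f x).det| ∂μ := by
        refine setLIntegral_mono' hs fun x hx => ENNReal.ofReal_le_ofReal ?_
        rw [abs_det_of_isConformalMap (conformalAt_iff_isConformalMap_fderiv.1 (hf x hx))]
        exact pow_le_pow_left₀ hc (hcf x hx) _
    _ = μ (f '' s) := lintegral_abs_det_fderiv_eq_addHaar_image μ hs hderiv hinj

end ConformalVolume

section Oscillation

open Metric

variable {E F : Type*} [NormedAddCommGroup E] [NormedSpace ℝ E] [NormedAddCommGroup F]
  [NormedSpace ℝ F] {V : Set E} {S T : Set (E × E)} {C C' : ℝ}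

variable (F) in
/-- `C` is an oscillation bound for the pairs in `S`: any map `V → F` whose derivative has norm at
most `M` on `V` moves the two points of each pair in `S` to within distance `C * M`. -/
def IsOscillationBound (V : Set E) (S : Set (E × E)) (C : ℝ) : Prop :=
  ∀ (f : E → F) (M : ℝ), (∀ x ∈ V, DifferentiableAt ℝ f x) → (∀ x ∈ V, ‖fderiv ℝ f x‖ ≤ M) →
    ∀ p ∈ S, dist (f p.1) (f p.2) ≤ C * M

namespace IsOscillationBound

theorem mono (h : IsOscillationBound F V T C) (hST : S ⊆ T) : IsOscillationBound F V S C :=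
  fun f M hd hf p hp => h f M hd hf p (hST hp)

theorem mono_right (h : IsOscillationBound F V S C) (hV : V.Nonempty) (hCC' : C ≤ C') :
    IsOscillationBound F V S C' := by
  intro f M hd hf p hp
  obtain ⟨x, hx⟩ := hV
  have hM : 0 ≤ M := (norm_nonneg _).trans (hf x hx)
  exact (h f M hd hf p hp).trans (mul_le_mul_of_nonneg_right hCC' hM)

theorem union (hS : IsOscillationBound F V S C) (hT : IsOscillationBound F V T C) :
    IsOscillationBound F V (S ∪ T) C := by
  rintro f M hd hf p (hp | hp)
  exacts [hS f M hd hf p hp, hT f M hd hf p hp]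

theorem swap (h : IsOscillationBound F V S C) : IsOscillationBound F V (Prod.swap ⁻¹' S) C :=
  fun f M hd hf p hp => (dist_comm _ _).trans_le (h f M hd hf p.swap hp)

theorem trans {s t : Set E} {y : E} (h : IsOscillationBound F V (s ×ˢ {y}) C)
    (h' : IsOscillationBound F V ({y} ×ˢ t) C') : IsOscillationBound F V (s ×ˢ t) (C + C') := by
  rintro f M hd hf ⟨x, z⟩ ⟨hx, hz⟩
  rw [add_mul]
  exact (dist_triangle _ (f y) _).trans
    (add_le_add (h f M hd hf (x, y) ⟨hx, rfl⟩) (h' f M hd hf (y, z) ⟨rfl, hz⟩))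

theorem ball_prod_center {x : E} {r : ℝ} (hball : ball x r ⊆ V) :
    IsOscillationBound F V (ball x r ×ˢ {x}) r := by
  rintro f M hd hf ⟨y, z⟩ ⟨hy, hz⟩
  obtain rfl : x = z := hz.symm
  have hx : x ∈ ball x r := mem_ball_self (pos_of_mem_ball hy)
  have hM : 0 ≤ M := (norm_nonneg _).trans (hf x (hball hx))
  calc dist (f y) (f x) ≤ M * dist y x := by
        simp only [dist_eq_norm]
        exact (convex_ball x r).norm_image_sub_le_of_norm_fderiv_le
          (fun w hw => hd w (hball hw)) (fun w hw => hf w (hball hw)) hx hy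
    _ ≤ r * M := by
        rw [mul_comm]
        exact mul_le_mul_of_nonneg_right (mem_ball.1 hy).le hM

end IsOscillationBound

theorem exists_isOscillationBound_singleton (hV : IsOpen V) (hVc : IsPreconnected V) {x y : E}
    (hx : x ∈ V) (hy : y ∈ V) : ∃ C, IsOscillationBound F V ({x} ×ˢ {y}) C := by
  refine hVc.induction₂ (fun x y => ∃ C, IsOscillationBound F V ({x} ×ˢ {y}) C)
    (fun x hx => ?_) (fun x y z _ _ _ ⟨C, h⟩ ⟨C', h'⟩ => ⟨C + C', h.trans h'⟩)
    (fun x y _ _ ⟨C, h⟩ => ⟨C, h.swap.mono fun _ ⟨h₁, h₂⟩ => ⟨h₂, h₁⟩⟩) hx hy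
  obtain ⟨r, hr, hball⟩ := isOpen_iff.1 hV x hx
  filter_upwards [mem_nhdsWithin_of_mem_nhds (ball_mem_nhds x hr)] with y hy
  exact ⟨r, (IsOscillationBound.ball_prod_center hball).swap.mono
    fun _ ⟨h₁, h₂⟩ => ⟨Set.mem_of_eq_of_mem h₂ hy, h₁⟩⟩

theorem exists_isOscillationBound_of_isCompact (hV : IsOpen V) (hVc : IsConnected V) {X : Set E}
    (hX : IsCompact X) (hXV : X ⊆ V) : ∃ C, IsOscillationBound F V (X ×ˢ X) C := by
  refine (hX.prod hX).induction_on (p := fun S => ∃ C, IsOscillationBound F V S C)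
    ⟨0, fun _ _ _ _ _ hp => hp.elim⟩ (fun S T hST ⟨C, h⟩ => ⟨C, h.mono hST⟩)
    (fun S T ⟨C, h⟩ ⟨C', h'⟩ => ⟨max C C', (h.mono_right hVc.nonempty (le_max_left C C')).union
      (h'.mono_right hVc.nonempty (le_max_right C C'))⟩) ?_
  rintro ⟨x, y⟩ ⟨hx, hy⟩
  obtain ⟨r, hr, hballx⟩ := isOpen_iff.1 hV x (hXV hx)
  obtain ⟨r', hr', hbally⟩ := isOpen_iff.1 hV y (hXV hy)
  obtain ⟨C, hC⟩ := exists_isOscillationBound_singleton (F := F) hV hVc.isPreconnected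
    (hXV hx) (hXV hy)
  refine ⟨ball x r ×ˢ ball y r', mem_nhdsWithin_of_mem_nhds
    (prod_mem_nhds (ball_mem_nhds x hr) (ball_mem_nhds y hr')), r + (C + r'), ?_⟩
  exact (IsOscillationBound.ball_prod_center hballx).trans
    (hC.trans ((IsOscillationBound.ball_prod_center hbally).swap.mono
      fun _ ⟨h₁, h₂⟩ => ⟨h₂, h₁⟩))

end Oscillation

section QuadraticRate

open Real

theorem tendsto_sum_range_div_sum_range {u v : ℕ → ℝ} {L : ℝ} (hv : ∀ n, 0 < v n)
    (hsum : Tendsto (fun n => ∑ k ∈ Finset.range n, v k) atTop atTop)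
    (h : Tendsto (fun n => u n / v n) atTop (𝓝 L)) :
    Tendsto (fun n => (∑ k ∈ Finset.range n, u k) / ∑ k ∈ Finset.range n, v k) atTop (𝓝 L) := by
  have hlo : (fun n => u n - L * v n) =o[atTop] v := by
    refine (Asymptotics.isLittleO_iff_tendsto fun n hn => absurd hn (hv n).ne').2 ?_
    refine (tendsto_sub_nhds_zero_iff.2 h).congr fun n => ?_
    rw [sub_div, mul_div_cancel_right₀ _ (hv n).ne']
  have hlim := (hlo.sum_range (fun n => (hv n).le) hsum).tendsto_div_nhds_zero
  refine tendsto_sub_nhds_zero_iff.1 (hlim.congr' ?_)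
  filter_upwards [hsum.eventually_gt_atTop 0] with n hn
  rw [Finset.sum_sub_distrib, ← Finset.mul_sum, sub_div, mul_div_cancel_right₀ _ hn.ne']

theorem sum_range_cast_add_one (n : ℕ) :
    ∑ k ∈ Finset.range n, ((k : ℝ) + 1) = (n : ℝ) * (n + 1) / 2 := by
  induction n with
  | zero => simp
  | succ n ih => rw [Finset.sum_range_succ, ih]; push_cast; ring

theorem tendsto_sum_range_div_sq {u : ℕ → ℝ} {L : ℝ}
    (h : Tendsto (fun n : ℕ => u n / ((n : ℝ) + 1)) atTop (𝓝 L)) :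
    Tendsto (fun n : ℕ => (∑ k ∈ Finset.range n, u k) / (n : ℝ) ^ 2) atTop (𝓝 (L / 2)) := by
  have hsum : Tendsto (fun n => ∑ k ∈ Finset.range n, ((k : ℝ) + 1)) atTop atTop := by
    refine tendsto_atTop_mono (fun n => ?_)
      (tendsto_natCast_atTop_atTop.atTop_div_const two_pos)
    rw [sum_range_cast_add_one]
    nlinarith [sq_nonneg (n : ℝ)]
  have hsq : Tendsto (fun n : ℕ => (1 + (n : ℝ)⁻¹) / 2) atTop (𝓝 (1 / 2)) := by
    simpa using (tendsto_inv_atTop_nhds_zero_nat (𝕜 := ℝ)).const_add 1 |>.div_const 2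
  have hlim := (tendsto_sum_range_div_sum_range (fun n => by positivity) hsum h).mul hsq
  rw [mul_one_div] at hlim
  refine hlim.congr' ?_
  filter_upwards [eventually_gt_atTop 0] with n hn
  have hn : (n : ℝ) ≠ 0 := by positivity
  rw [sum_range_cast_add_one]
  field_simp

/-- The positive sequence `u` is of the form `u n = exp (L n² + o(n²))`. -/
structure HasQuadraticRate (u : ℕ → ℝ) (L : ℝ) : Prop where
  pos : ∀ n, 0 < u n
  tendsto : Tendsto (fun n : ℕ => log (u n) / (n : ℝ) ^ 2) atTop (𝓝 L)

namespace HasQuadraticRate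

variable {u v : ℕ → ℝ} {L L' : ℝ}

theorem const {c : ℝ} (hc : 0 < c) : HasQuadraticRate (fun _ => c) 0 where
  pos _ := hc
  tendsto := tendsto_const_nhds.div_atTop
    ((tendsto_pow_atTop two_ne_zero).comp tendsto_natCast_atTop_atTop)

theorem exp_natCast : HasQuadraticRate (fun n => exp n) 0 where
  pos n := exp_pos n
  tendsto := by
    refine (tendsto_inv_atTop_nhds_zero_nat (𝕜 := ℝ)).congr fun n => ?_
    rw [log_exp, sq, div_self_mul_self']

theorem mul (hu : HasQuadraticRate u L) (hv : HasQuadraticRate v L') :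
    HasQuadraticRate (fun n => u n * v n) (L + L') where
  pos n := mul_pos (hu.pos n) (hv.pos n)
  tendsto := (hu.tendsto.add hv.tendsto).congr fun n => by
    rw [log_mul (hu.pos n).ne' (hv.pos n).ne', add_div]

theorem div (hu : HasQuadraticRate u L) (hv : HasQuadraticRate v L') :
    HasQuadraticRate (fun n => u n / v n) (L - L') where
  pos n := div_pos (hu.pos n) (hv.pos n)
  tendsto := (hu.tendsto.sub hv.tendsto).congr fun n => by
    rw [log_div (hu.pos n).ne' (hv.pos n).ne', sub_div]

theorem rpow (hu : HasQuadraticRate u L) (t : ℝ) :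
    HasQuadraticRate (fun n => u n ^ t) (t * L) where
  pos n := rpow_pos_of_pos (hu.pos n) t
  tendsto := (hu.tendsto.const_mul t).congr fun n => by rw [log_rpow (hu.pos n), mul_div_assoc]

theorem pow (hu : HasQuadraticRate u L) (k : ℕ) :
    HasQuadraticRate (fun n => u n ^ k) (k * L) := by
  simpa only [rpow_natCast] using hu.rpow k

theorem succ (hu : HasQuadraticRate u L) : HasQuadraticRate (fun n => u (n + 1)) L where
  pos n := hu.pos (n + 1)
  tendsto := by
    have hsq : Tendsto (fun n : ℕ => (1 + (n : ℝ)⁻¹) ^ 2) atTop (𝓝 1) := by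
      simpa using ((tendsto_inv_atTop_nhds_zero_nat (𝕜 := ℝ)).const_add 1).pow 2
    have hlim := (hu.tendsto.comp (tendsto_add_atTop_nat 1)).mul hsq
    rw [mul_one] at hlim
    refine hlim.congr' ?_
    filter_upwards [eventually_gt_atTop 0] with n hn
    have hn : (n : ℝ) ≠ 0 := by positivity
    simp only [Function.comp, Nat.cast_add, Nat.cast_one]
    field_simp

theorem eventually_le (hu : HasQuadraticRate u L) (hv : HasQuadraticRate v L') (hL : L < L') :
    ∀ᶠ n in atTop, u n ≤ v n := by
  filter_upwards [hu.tendsto.eventually_lt hv.tendsto hL, eventually_gt_atTop 0] with n hlt hn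
  rw [div_lt_div_iff_of_pos_right (by positivity)] at hlt
  exact ((log_lt_log_iff (hu.pos n) (hv.pos n)).1 hlt).le

theorem tendsto_zero (hu : HasQuadraticRate u L) (hL : L < 0) : Tendsto u atTop (𝓝 0) := by
  refine squeeze_zero' (Eventually.of_forall fun n => (hu.pos n).le)
    (hu.eventually_le ((const one_pos).div exp_natCast) (by rwa [sub_self])) ?_
  exact tendsto_const_nhds.div_atTop (tendsto_exp_atTop.comp tendsto_natCast_atTop_atTop)

theorem prod_range (hu : ∀ n, 0 < u n)
    (h : Tendsto (fun n : ℕ => log (u n) / ((n : ℝ) + 1)) atTop (𝓝 L)) :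
    HasQuadraticRate (fun n => ∏ k ∈ Finset.range n, u k) (L / 2) where
  pos n := Finset.prod_pos fun k _ => hu k
  tendsto := (tendsto_sum_range_div_sq h).congr fun n => by
    rw [log_prod fun k _ => (hu k).ne']

end HasQuadraticRate

theorem tendsto_log_const_mul_div_add_one {u : ℕ → ℝ} {c L : ℝ} (hc : c ≠ 0) (hu : ∀ n, u n ≠ 0)
    (h : Tendsto (fun n : ℕ => log (u n) / ((n : ℝ) + 1)) atTop (𝓝 L)) :
    Tendsto (fun n : ℕ => log (c * u n) / ((n : ℝ) + 1)) atTop (𝓝 L) := by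
  have hlim := ((tendsto_one_div_add_atTop_nhds_zero_nat (𝕜 := ℝ)).const_mul (log c)).add h
  rw [mul_zero, zero_add] at hlim
  refine hlim.congr fun n => ?_
  rw [log_mul hc (hu n), add_div, mul_one_div]

end QuadraticRate

section HausdorffDimension

open MeasureTheory Metric

variable {E : Type*} [EMetricSpace E] [MeasurableSpace E] [BorelSpace E]

theorem dimH_le_of_frequently_card_mul_rpow_le {ι : ℕ → Type*} [∀ n, Finite (ι n)] {S : Set E}
    {t : ∀ n, ι n → Set E} {r : ℕ → ℝ≥0∞} {s : ℝ≥0} {C : ℝ≥0∞} (hr : Tendsto r atTop (𝓝 0))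
    (ht : ∀ᶠ n in atTop, ∀ i, ediam (t n i) ≤ r n) (hS : ∀ᶠ n in atTop, S ⊆ ⋃ i, t n i)
    (hC : C ≠ ∞) (hcard : ∃ᶠ n in atTop, Nat.card (ι n) * r n ^ (s : ℝ) ≤ C) : dimH S ≤ s := by
  have := fun n => Fintype.ofFinite (ι n)
  refine dimH_le_of_hausdorffMeasure_ne_top (ne_top_of_le_ne_top hC ?_)
  refine (Measure.hausdorffMeasure_le_liminf_sum (s : ℝ) S r hr t ht hS).trans
    (liminf_le_of_frequently_le' ((hcard.and_eventually ht).mono fun n ⟨hn, hdiam⟩ => ?_))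
  calc ∑ i, ediam (t n i) ^ (s : ℝ) ≤ ∑ _i : ι n, r n ^ (s : ℝ) :=
        Finset.sum_le_sum fun i _ => ENNReal.rpow_le_rpow (hdiam i) s.2
    _ = Nat.card (ι n) * r n ^ (s : ℝ) := by
        rw [Finset.sum_const, nsmul_eq_mul, Finset.card_univ, Nat.card_eq_fintype_card]
    _ ≤ C := hn

theorem exists_ge_le_and_succ_lt {α : Type*} [LinearOrder α] {r : ℕ → α} {δ : α} {n₀ : ℕ}
    (h₀ : δ ≤ r n₀) (hlt : ∃ N ≥ n₀, r N < δ) : ∃ n ≥ n₀, δ ≤ r n ∧ r (n + 1) < δ := by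
  by_contra! hsucc
  obtain ⟨N, hN, hNδ⟩ := hlt
  exact hNδ.not_ge (Nat.le_induction h₀ hsucc N hN)

/-- A mass distribution principle. Comparing `ν A` with the scale following the diameter of `A`
makes it applicable to scales that decay arbitrarily fast. -/
theorem le_hausdorffMeasure_of_eventually_le {ν : Measure E} {r : ℕ → ℝ≥0∞} {s : ℝ} (hs : 0 ≤ s)
    (hr0 : ∀ n, r n ≠ 0) (hr : Tendsto r atTop (𝓝 0))
    (hν : ∀ᶠ n in atTop, ∀ A, ediam A ≤ r n → ν A ≤ r (n + 1) ^ s) : ν ≤ μH[s] := by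
  obtain ⟨n₀, hn₀⟩ := eventually_atTop.1 hν
  refine Measure.le_hausdorffMeasure s ν (r n₀) (pos_iff_ne_zero.2 (hr0 n₀)) fun A hA => ?_
  rcases eq_or_ne (ediam A) 0 with h0 | h0
  · have hlim : Tendsto (fun n => r (n + 1) ^ s) atTop (𝓝 (ediam A ^ s)) := by
      rw [h0]
      exact ((ENNReal.continuous_rpow_const (y := s)).tendsto 0).comp
        (hr.comp (tendsto_add_atTop_nat 1))
    refine ge_of_tendsto hlim ?_
    filter_upwards [eventually_ge_atTop n₀] with n hn
    exact hn₀ n hn A (h0.trans_le zero_le)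
  · obtain ⟨N, hNn₀, hN⟩ := ((eventually_ge_atTop n₀).and
      (hr.eventually_lt_const (pos_iff_ne_zero.2 h0))).exists
    obtain ⟨n, hn, hle, hlt⟩ := exists_ge_le_and_succ_lt hA ⟨N, hNn₀, hN⟩
    exact (hn₀ n hn A hle).trans (ENNReal.rpow_le_rpow hlt.le hs)

end HausdorffDimension

section Counting

open MeasureTheory ProbabilityTheory

theorem ncard_mul_le_measure_of_pairwiseDisjoint {α ι : Type*} [MeasurableSpace α]
    {μ : Measure α} {A : Set ι} (hA : A.Finite) {t : ι → Set α} {B : Set α} {c : ℝ≥0∞}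
    (hdisj : A.PairwiseDisjoint t) (hmeas : ∀ i ∈ A, MeasurableSet (t i))
    (hsub : ∀ i ∈ A, t i ⊆ B) (hc : ∀ i ∈ A, c ≤ μ (t i)) : A.ncard * c ≤ μ B := by
  lift A to Finset ι using hA
  calc (A : Set ι).ncard * c = ∑ _i ∈ A, c := by
        rw [Set.ncard_coe_finset, Finset.sum_const, nsmul_eq_mul]
    _ ≤ ∑ i ∈ A, μ (t i) := Finset.sum_le_sum hc
    _ = μ (⋃ i ∈ A, t i) := (measure_biUnion_finset hdisj hmeas).symm
    _ ≤ μ B := measure_mono (Set.iUnion₂_subset hsub)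

theorem uniformOn_univ_apply_eq_ncard_div {Ω : Type*} [MeasurableSpace Ω]
    [MeasurableSingletonClass Ω] [Finite Ω] (A : Set Ω) :
    uniformOn Set.univ A = A.ncard / Nat.card Ω := by
  have := Fintype.ofFinite Ω
  rw [uniformOn_univ, Measure.count_apply_finite A A.toFinite, Set.ncard_eq_toFinset_card,
    Nat.card_eq_fintype_card]

theorem pi_uniformOn_univ {ι : Type*} [Fintype ι] {Ω : ι → Type*} [∀ i, MeasurableSpace (Ω i)]
    [∀ i, MeasurableSingletonClass (Ω i)] [∀ i, Finite (Ω i)] :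
    Measure.pi (fun i => uniformOn (Set.univ : Set (Ω i))) = uniformOn Set.univ := by
  refine Measure.ext_of_singleton fun ω => ?_
  simp only [Measure.pi_singleton, uniformOn_univ_apply_eq_ncard_div, Set.ncard_singleton,
    Nat.cast_one, one_div, Nat.card_pi, Nat.cast_prod]
  exact (ENNReal.prod_inv_distrib fun _ _ _ _ _ => Or.inr (ENNReal.natCast_ne_top _)).symm

theorem infinitePi_uniformOn_univ_preimage {ι κ : Type*} [Finite κ] {Ω : ι → Type*}
    [∀ i, MeasurableSpace (Ω i)] [∀ i, MeasurableSingletonClass (Ω i)] [∀ i, Finite (Ω i)]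
    [∀ i, Nonempty (Ω i)] {f : κ → ι} (hf : f.Injective) (A : Set (∀ k, Ω (f k))) :
    Measure.infinitePi (fun i => uniformOn (Set.univ : Set (Ω i))) {w | (fun k => w (f k)) ∈ A} =
      A.ncard / Nat.card (∀ k, Ω (f k)) := by
  have := Fintype.ofFinite κ
  have hmap : (Measure.infinitePi fun i => uniformOn (Set.univ : Set (Ω i))).map
      (fun w k => w (f k)) = uniformOn Set.univ := by
    rw [Measure.map_infinitePi_infinitePi_of_inj (P := fun i => uniformOn (Set.univ : Set (Ω i)))
      hf, Measure.infinitePi_eq_pi, pi_uniformOn_univ]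
  rw [← uniformOn_univ_apply_eq_ncard_div, ← hmap,
    Measure.map_apply (by fun_prop) A.toFinite.measurableSet]
  rfl

end Counting

section NonautonomousIFS

open MeasureTheory ProbabilityTheory Metric Set

variable {d : ℕ} {X : Set (EuclideanSpace ℝ (Fin d))}

theorem derivNorm_mem_Icc {f : EuclideanSpace ℝ (Fin d) → EuclideanSpace ℝ (Fin d)} {l u : ℝ}
    (hX : X.Nonempty) (hf : ∀ x ∈ X, ‖fderiv ℝ f x‖ ∈ Icc l u) : derivNorm X f ∈ Icc l u := by
  have hub : ∀ r ∈ (fun x => ‖fderiv ℝ f x‖) '' X, r ≤ u :=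
    forall_mem_image.2 fun x hx => (hf x hx).2
  obtain ⟨x, hx⟩ := hX
  exact ⟨(hf x hx).1.trans (le_csSup ⟨u, hub⟩ ⟨x, hx, rfl⟩), csSup_le ⟨_, x, hx, rfl⟩ hub⟩

theorem lt_mul_of_ofReal_div_lt {a b : ℝ} {t : ℝ≥0} (hb : 0 < b)
    (h : ENNReal.ofReal (a / b) < t) : a < t * b :=
  (div_lt_iff₀ hb).1 ((Real.le_coe_toNNReal _).trans_lt (ENNReal.coe_lt_coe.1 h))

theorem mul_lt_of_lt_ofReal_div {a b : ℝ} {t : ℝ≥0} (hb : 0 < b)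
    (h : t < ENNReal.ofReal (a / b)) : t * b < a :=
  (lt_div_iff₀ hb).1 (ENNReal.coe_lt_ofReal.1 h)

namespace NCIFS

variable (Φ : NCIFS.{u} X)

instance (j : ℕ) : Nonempty (Φ.I j) := Φ.nonempty j

theorem injOn_wordMap (m n : ℕ) (ω : Word Φ.I m n) : InjOn (wordMap Φ.map m n ω) Φ.V := by
  induction n with
  | zero => exact injOn_id _
  | succ n ih => exact (ih _).comp (Φ.injOn_V _ _) (Φ.mapsTo_V _ _)

theorem conformalAt_wordMap (m n : ℕ) (ω : Word Φ.I m n) {x : EuclideanSpace ℝ (Fin d)}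
    (hx : x ∈ Φ.V) : ConformalAt (wordMap Φ.map m n ω) x := by
  induction n generalizing x with
  | zero => exact conformalAt_id x
  | succ n ih => exact (ih _ (Φ.mapsTo_V _ _ hx)).comp x (Φ.conformalAt_V _ _ x hx)

theorem continuousOn_wordMap (m n : ℕ) (ω : Word Φ.I m n) :
    ContinuousOn (wordMap Φ.map m n ω) Φ.V := fun _ hx =>
  (Φ.conformalAt_wordMap m n ω hx).differentiableAt.continuousAt.continuousWithinAt

theorem map_map_nhds (j : ℕ) (i : Φ.I j) {x : EuclideanSpace ℝ (Fin d)} (hx : x ∈ Φ.V) :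
    Filter.map (Φ.map j i) (𝓝 x) = 𝓝 (Φ.map j i x) := by
  have hstrict : HasStrictFDerivAt (Φ.map j i) (fderiv ℝ (Φ.map j i) x) x :=
    ((Φ.contDiffOn_V j i).contDiffAt (Φ.isOpen_V.mem_nhds hx)).hasStrictFDerivAt one_ne_zero
  exact hstrict.map_nhds_eq_of_surj (range_eq_top_of_isConformalMap
    (conformalAt_iff_isConformalMap_fderiv.1 (Φ.conformalAt_V j i x hx)))

theorem mapsTo_interior (j : ℕ) (i : Φ.I j) :
    MapsTo (Φ.map j i) (interior X) (interior X) := by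
  intro x hx
  rw [mem_interior_iff_mem_nhds, ← Φ.map_map_nhds j i (Φ.subset_V (interior_subset hx)),
    Filter.mem_map]
  exact mem_of_superset (mem_interior_iff_mem_nhds.1 hx) (Φ.mapsTo j i)

theorem interior_subset_V : interior X ⊆ Φ.V := interior_subset.trans Φ.subset_V

theorem disjoint_wordMap_image_interior (m n : ℕ) {ω ω' : Word Φ.I m n} (h : ω ≠ ω') :
    Disjoint (wordMap Φ.map m n ω '' interior X) (wordMap Φ.map m n ω' '' interior X) := by
  induction n with
  | zero => exact absurd (Subsingleton.elim ω ω') h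
  | succ n ih =>
    simp only [wordMap, image_comp]
    have hint : ∀ i : Φ.I (m + n), Φ.map (m + n) i '' interior X ⊆ interior X := fun i =>
      (Φ.mapsTo_interior _ i).image_subset
    by_cases hinit : (fun k : Fin n => ω k.castSucc) = fun k : Fin n => ω' k.castSucc
    · have hlast : ω (Fin.last n) ≠ ω' (Fin.last n) := fun hlast =>
        h (funext fun k => Fin.lastCases hlast (congrFun hinit) k)
      have hV : ∀ i : Φ.I (m + n), Φ.map (m + n) i '' interior X ⊆ Φ.V := fun i =>
        (hint i).trans Φ.interior_subset_V
      rw [hinit]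
      rw [disjoint_iff_inter_eq_empty, ← (Φ.injOn_wordMap m n _).image_inter (hV _) (hV _)]
      exact image_eq_empty.2 (Φ.open_set_condition _ _ _ hlast).inter_eq
    · exact (ih hinit).mono (image_mono (hint _)) (image_mono (hint _))

theorem exists_norm_fderiv_map_mem_Icc (hX : X.Nonempty) :
    ∃ K : ℝ, 0 < K ∧ ∀ (j : ℕ) (i : Φ.I j), ∀ x ∈ Φ.V, ‖fderiv ℝ (Φ.map j i) x‖ ∈
      Icc (K⁻¹ * derivNorm X (Φ.map j i)) (K * derivNorm X (Φ.map j i)) := by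
  obtain ⟨K, hK, hdist⟩ := Φ.bounded_distortion
  have hK0 : 0 < K := one_pos.trans_le hK
  refine ⟨K, hK0, fun j i x hx => ?_⟩
  have hmap : ∀ y ∈ Φ.V, ∀ z ∈ Φ.V, ‖fderiv ℝ (Φ.map j i) y‖ ≤ K * ‖fderiv ℝ (Φ.map j i) z‖ :=
    hdist j 1 (Fin.cons i finZeroElim)
  obtain ⟨hle, hge⟩ := derivNorm_mem_Icc hX fun z hz =>
    ⟨(inv_mul_le_iff₀ hK0).2 (hmap x hx z (Φ.subset_V hz)), hmap z (Φ.subset_V hz) x hx⟩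
  exact ⟨(inv_mul_le_iff₀ hK0).2 hge, (inv_mul_le_iff₀ hK0).1 hle⟩

theorem derivNorm_map_pos [NeZero d] (hX : X.Nonempty) (j : ℕ) (i : Φ.I j) :
    0 < derivNorm X (Φ.map j i) := by
  obtain ⟨K, hK, hbound⟩ := Φ.exists_norm_fderiv_map_mem_Icc hX
  obtain ⟨x, hx⟩ := Φ.isConnected_V.nonempty
  exact pos_of_mul_pos_right ((norm_fderiv_pos_of_conformalAt (Φ.conformalAt_V j i x hx)).trans_le
    (hbound j i x hx).2) hK.le

theorem norm_fderiv_wordMap_mem_Icc [NeZero d] {l u : ℕ → ℝ} (hl : ∀ j, 0 ≤ l j)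
    (hmap : ∀ j i, ∀ x ∈ Φ.V, ‖fderiv ℝ (Φ.map j i) x‖ ∈ Icc (l j) (u j)) (m n : ℕ)
    (ω : Word Φ.I m n) {x : EuclideanSpace ℝ (Fin d)} (hx : x ∈ Φ.V) :
    ‖fderiv ℝ (wordMap Φ.map m n ω) x‖ ∈
      Icc (∏ k ∈ Finset.range n, l (m + k)) (∏ k ∈ Finset.range n, u (m + k)) := by
  induction n generalizing x with
  | zero =>
    have hid : fderiv ℝ (wordMap Φ.map m 0 ω) x = ContinuousLinearMap.id ℝ _ := fderiv_id
    simp [hid]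
  | succ n ih =>
    have hx' := Φ.mapsTo_V (m + n) (ω (Fin.last n)) hx
    have hinit := ih (fun k => ω k.castSucc) hx'
    have hlast := hmap (m + n) (ω (Fin.last n)) x hx
    rw [Finset.prod_range_succ, Finset.prod_range_succ, wordMap, norm_fderiv_comp_of_conformalAt
      (Φ.conformalAt_wordMap m n _ hx') (Φ.conformalAt_V (m + n) (ω (Fin.last n)) x hx)]
    exact ⟨mul_le_mul hinit.1 hlast.1 (hl _) (norm_nonneg _),
      mul_le_mul hinit.2 hlast.2 (norm_nonneg _) ((norm_nonneg _).trans hinit.2)⟩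

/-- The derivatives of the maps of the words of length `n` lie between `m n` and `M n`, and both
are of the form `exp (-β n² + o(n²))`. -/
structure HasScales (β : ℝ) (m M : ℕ → ℝ) : Prop where
  norm_fderiv_mem_Icc : ∀ n (ω : Word Φ.I 0 n), ∀ x ∈ Φ.V,
    ‖fderiv ℝ (wordMap Φ.map 0 n ω) x‖ ∈ Icc (m n) (M n)
  lower : HasQuadraticRate m (-β)
  upper : HasQuadraticRate M (-β)

theorem exists_norm_fderiv_map_mem_Icc_of_tendsto [NeZero d] [∀ n, Finite (Φ.I n)]
    (hX : X.Nonempty) {b : ℝ}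
    (hlim : ∀ r : ∀ n, Φ.I n, Tendsto
      (fun n : ℕ => Real.log (derivNorm X (Φ.map n (r n))) / ((n : ℝ) + 1)) atTop (𝓝 b)) :
    ∃ l u : ℕ → ℝ, (∀ j, 0 < l j) ∧ (∀ j, 0 < u j) ∧
      (∀ j i, ∀ x ∈ Φ.V, ‖fderiv ℝ (Φ.map j i) x‖ ∈ Icc (l j) (u j)) ∧
      Tendsto (fun n : ℕ => Real.log (l n) / ((n : ℝ) + 1)) atTop (𝓝 b) ∧
      Tendsto (fun n : ℕ => Real.log (u n) / ((n : ℝ) + 1)) atTop (𝓝 b) := by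
  obtain ⟨K, hK, hbound⟩ := Φ.exists_norm_fderiv_map_mem_Icc hX
  have hpos := Φ.derivNorm_map_pos hX
  choose p hp using fun n => Finite.exists_max fun i : Φ.I n => derivNorm X (Φ.map n i)
  choose q hq using fun n => Finite.exists_min fun i : Φ.I n => derivNorm X (Φ.map n i)
  have hrate : ∀ (c : ℝ) (r : ∀ n, Φ.I n), 0 < c → Tendsto
      (fun n : ℕ => Real.log (c * derivNorm X (Φ.map n (r n))) / ((n : ℝ) + 1)) atTop (𝓝 b) :=
    fun c r hc => tendsto_log_const_mul_div_add_one hc.ne' (fun n => (hpos n (r n)).ne') (hlim r)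
  refine ⟨_, _, fun j => mul_pos (inv_pos.2 hK) (hpos j (q j)), fun j => mul_pos hK (hpos j (p j)),
    fun j i x hx => ?_, hrate K⁻¹ q (inv_pos.2 hK), hrate K p hK⟩
  obtain ⟨hle, hge⟩ := hbound j i x hx
  exact ⟨(mul_le_mul_of_nonneg_left (hq j i) (inv_pos.2 hK).le).trans hle,
    hge.trans (mul_le_mul_of_nonneg_left (hp j i) hK.le)⟩

theorem exists_hasScales [NeZero d] [∀ n, Finite (Φ.I n)] (hX : X.Nonempty) {b : ℝ}
    (hlim : ∀ r : ∀ n, Φ.I n, Tendsto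
      (fun n : ℕ => Real.log (derivNorm X (Φ.map n (r n))) / ((n : ℝ) + 1)) atTop (𝓝 (-b))) :
    ∃ m M : ℕ → ℝ, Φ.HasScales (b / 2) m M := by
  obtain ⟨l, u, hl, hu, hmap, hl_lim, hu_lim⟩ :=
    Φ.exists_norm_fderiv_map_mem_Icc_of_tendsto hX hlim
  refine ⟨fun n => ∏ k ∈ Finset.range n, l k, fun n => ∏ k ∈ Finset.range n, u k,
    fun n ω x hx => ?_, ?_, ?_⟩
  · simpa only [zero_add] using Φ.norm_fderiv_wordMap_mem_Icc (fun j => (hl j).le) hmap 0 n ω hx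
  · exact neg_div 2 b ▸ .prod_range hl hl_lim
  · exact neg_div 2 b ▸ .prod_range hu hu_lim

theorem hasQuadraticRate_card_word [∀ n, Finite (Φ.I n)] {a : ℝ}
    (hlim : Tendsto (fun n : ℕ => Real.log (Nat.card (Φ.I n)) / ((n : ℝ) + 1)) atTop (𝓝 a)) :
    HasQuadraticRate (fun n => (Nat.card (Word Φ.I 0 n) : ℝ)) (a / 2) := by
  have hcard : ∀ n, Nat.card (Word Φ.I 0 n) = ∏ k ∈ Finset.range n, Nat.card (Φ.I k) := by
    intro n
    rw [Nat.card_pi, Fin.prod_univ_eq_prod_range (fun k => Nat.card (Φ.I (0 + k)))]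
    simp only [zero_add]
  simp only [hcard, Nat.cast_prod]
  exact .prod_range (fun n => Nat.cast_pos.2 Nat.card_pos) hlim

/-- The piece `φ_ω(X)` of the level set of level `n`. -/
def piece (n : ℕ) (ω : Word Φ.I 0 n) : Set (EuclideanSpace ℝ (Fin d)) :=
  wordMap Φ.map 0 n ω '' X

/-- The words of length `n` whose pieces meet `s`. -/
def piecesMeeting (n : ℕ) (s : Set (EuclideanSpace ℝ (Fin d))) : Set (Word Φ.I 0 n) :=
  {ω | (Φ.piece n ω ∩ s).Nonempty}

theorem limitSet_subset_iUnion_piece {n : ℕ} (hn : 1 ≤ n) : Φ.limitSet ⊆ ⋃ ω, Φ.piece n ω :=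
  iInter₂_subset n hn

theorem isCompact_piece (hX : IsCompact X) (n : ℕ) (ω : Word Φ.I 0 n) :
    IsCompact (Φ.piece n ω) :=
  hX.image_of_continuousOn ((Φ.continuousOn_wordMap 0 n ω).mono Φ.subset_V)

theorem isClosed_limitSet [∀ n, Finite (Φ.I n)] (hX : IsCompact X) : IsClosed Φ.limitSet :=
  isClosed_biInter fun n _ => isClosed_iUnion_of_finite fun ω => (Φ.isCompact_piece hX n ω).isClosed

theorem exists_forall_mem_piece (hX : IsCompact X) (hne : X.Nonempty) (w : ∀ k, Φ.I (0 + k)) :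
    ∃ p, ∀ n, p ∈ Φ.piece n fun k => w k := by
  have hanti : ∀ n, (Φ.piece (n + 1) fun k => w k) ⊆ Φ.piece n fun k => w k := fun n => by
    simp only [piece, wordMap, image_comp]
    exact image_mono (Φ.mapsTo _ _).image_subset
  obtain ⟨p, hp⟩ := IsCompact.nonempty_iInter_of_sequence_nonempty_isCompact_isClosed
    (fun n => Φ.piece n fun k => w k) hanti (fun n => hne.image _) (Φ.isCompact_piece hX 0 _)
    fun n => (Φ.isCompact_piece hX n _).isClosed
  exact ⟨p, mem_iInter.1 hp⟩

variable {Φ} {α β t : ℝ} {m M : ℕ → ℝ}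

namespace HasScales

theorem derivNorm_mem_Icc (h : Φ.HasScales β m M) (hX : X.Nonempty) (n : ℕ) (ω : Word Φ.I 0 n) :
    derivNorm X (wordMap Φ.map 0 n ω) ∈ Icc (m n) (M n) :=
  _root_.derivNorm_mem_Icc hX fun x hx => h.norm_fderiv_mem_Icc n ω x (Φ.subset_V hx)

theorem Z_mem_Icc [∀ n, Finite (Φ.I n)] (h : Φ.HasScales β m M) (hX : X.Nonempty) (n : ℕ)
    (t : ℝ≥0) : Φ.Z n t ∈ Icc (ENNReal.ofReal (Nat.card (Word Φ.I 0 n) * m n ^ (t : ℝ)))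
      (ENNReal.ofReal (Nat.card (Word Φ.I 0 n) * M n ^ (t : ℝ))) := by
  have := Fintype.ofFinite (Word Φ.I 0 n)
  have hderiv := h.derivNorm_mem_Icc hX n
  have hm := (h.lower.pos n).le
  simp only [Z, tsum_fintype, ENNReal.ofReal_mul (Nat.cast_nonneg _), ENNReal.ofReal_natCast,
    Nat.card_eq_fintype_card]
  simp only [← nsmul_eq_mul]
  exact ⟨Finset.card_nsmul_le_sum _ _ _ fun ω _ =>
      ENNReal.ofReal_le_ofReal (Real.rpow_le_rpow hm (hderiv ω).1 t.2),
    Finset.sum_le_card_nsmul _ _ _ fun ω _ => ENNReal.ofReal_le_ofReal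
      (Real.rpow_le_rpow (hm.trans (hderiv ω).1) (hderiv ω).2 t.2)⟩

theorem eventually_card_mul_rpow_le_one (h : Φ.HasScales β m M)
    (hW : HasQuadraticRate (fun n => (Nat.card (Word Φ.I 0 n) : ℝ)) α) {C : ℝ} (hC : 0 < C)
    (ht : α < t * β) :
    ∀ᶠ n in atTop, (Nat.card (Word Φ.I 0 n) : ℝ) * (C * M n) ^ t ≤ 1 :=
  (hW.mul (((HasQuadraticRate.const hC).mul h.upper).rpow t)).eventually_le
    (.const one_pos) (by linarith)

theorem lowerPressure_nonpos [∀ n, Finite (Φ.I n)] (h : Φ.HasScales β m M)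
    (hW : HasQuadraticRate (fun n => (Nat.card (Word Φ.I 0 n) : ℝ)) α) (hX : X.Nonempty)
    {t : ℝ≥0} (ht : α < t * β) : Φ.lowerPressure t ≤ 0 := by
  refine liminf_le_of_frequently_le' (Eventually.frequently ?_)
  filter_upwards [h.eventually_card_mul_rpow_le_one hW one_pos ht] with n hn
  rw [one_mul] at hn
  have hZ : Φ.Z n t ≤ 1 := (h.Z_mem_Icc hX n t).2.trans (ENNReal.ofReal_le_one.2 hn)
  exact EReal.div_nonpos_of_nonpos_of_nonneg
    (ENNReal.log_one ▸ ENNReal.log_monotone hZ) (Nat.cast_nonneg' n)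

theorem lowerPressure_pos [∀ n, Finite (Φ.I n)] (h : Φ.HasScales β m M)
    (hW : HasQuadraticRate (fun n => (Nat.card (Word Φ.I 0 n) : ℝ)) α) (hX : X.Nonempty)
    {t : ℝ≥0} (ht : t * β < α) : 0 < Φ.lowerPressure t := by
  have hexp := HasQuadraticRate.exp_natCast.eventually_le (hW.mul (h.lower.rpow t)) (by linarith)
  refine zero_lt_one.trans_le (le_liminf_of_le (by isBoundedDefault) ?_)
  filter_upwards [hexp, eventually_gt_atTop 0] with n hn hn0
  rw [EReal.le_div_iff_mul_le (by exact_mod_cast hn0) (EReal.natCast_ne_top n), one_mul]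
  calc (n : EReal) = ENNReal.log (ENNReal.ofReal (Real.exp n)) := by
        rw [ENNReal.log_ofReal_of_pos (Real.exp_pos _), Real.log_exp]
        rfl
    _ ≤ ENNReal.log (Φ.Z n t) := ENNReal.log_monotone
        ((ENNReal.ofReal_le_ofReal hn).trans (h.Z_mem_Icc hX n t).1)

theorem bowenDim_eq [∀ n, Finite (Φ.I n)] (h : Φ.HasScales β m M)
    (hW : HasQuadraticRate (fun n => (Nat.card (Word Φ.I 0 n) : ℝ)) α) (hX : X.Nonempty)
    (hβ : 0 < β) : Φ.bowenDim = ENNReal.ofReal (α / β) := by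
  refine le_antisymm (iSup₂_le fun t ht => ?_) (ENNReal.le_of_forall_nnreal_lt fun t ht => ?_)
  · by_contra! hlt
    exact (h.lowerPressure_nonpos hW hX (lt_mul_of_ofReal_div_lt hβ hlt)).not_gt ht
  · exact le_iSup₂_of_le t (h.lowerPressure_pos hW hX (mul_lt_of_lt_ofReal_div hβ ht)) le_rfl

theorem exists_ediam_piece_le (h : Φ.HasScales β m M) (hX : IsCompact X) :
    ∃ C : ℝ, 0 < C ∧ ∀ n ω, ediam (Φ.piece n ω) ≤ ENNReal.ofReal (C * M n) := by
  obtain ⟨C, hC⟩ := exists_isOscillationBound_of_isCompact (F := EuclideanSpace ℝ (Fin d))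
    Φ.isOpen_V Φ.isConnected_V hX Φ.subset_V
  refine ⟨max C 1, by positivity, fun n ω => ediam_le ?_⟩
  rintro _ ⟨x, hx, rfl⟩ _ ⟨y, hy, rfl⟩
  rw [edist_dist]
  exact ENNReal.ofReal_le_ofReal <| hC.mono_right Φ.isConnected_V.nonempty (le_max_left C 1) _ _
    (fun z hz => (Φ.conformalAt_wordMap 0 n ω hz).differentiableAt)
    (fun z hz => (h.norm_fderiv_mem_Icc n ω z hz).2) (x, y) ⟨hx, hy⟩

theorem tendsto_ofReal_mul_zero (h : Φ.HasScales β m M) (hβ : 0 < β) (C : ℝ) :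
    Tendsto (fun n => ENNReal.ofReal (C * M n)) atTop (𝓝 0) := by
  simpa using ENNReal.tendsto_ofReal ((h.upper.tendsto_zero (neg_neg_of_pos hβ)).const_mul C)

theorem dimH_limitSet_le [∀ n, Finite (Φ.I n)] (h : Φ.HasScales β m M)
    (hW : HasQuadraticRate (fun n => (Nat.card (Word Φ.I 0 n) : ℝ)) α) (hX : IsCompact X)
    (hβ : 0 < β) : dimH Φ.limitSet ≤ ENNReal.ofReal (α / β) := by
  obtain ⟨C, hC, hdiam⟩ := h.exists_ediam_piece_le hX
  by_contra! hlt
  obtain ⟨t, hαt, ht⟩ := ENNReal.lt_iff_exists_nnreal_btwn.1 hlt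
  refine ht.not_ge (dimH_le_of_frequently_card_mul_rpow_le (t := Φ.piece)
    (h.tendsto_ofReal_mul_zero hβ C) (Eventually.of_forall hdiam)
    ((eventually_ge_atTop 1).mono fun n hn => Φ.limitSet_subset_iUnion_piece hn)
    ENNReal.one_ne_top (Eventually.frequently ?_))
  filter_upwards [h.eventually_card_mul_rpow_le_one hW hC (lt_mul_of_ofReal_div_lt hβ hαt)]
    with n hn
  rw [ENNReal.ofReal_rpow_of_pos (mul_pos hC (h.upper.pos n)), ← ENNReal.ofReal_natCast,
    ← ENNReal.ofReal_mul (Nat.cast_nonneg _)]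
  exact ENNReal.ofReal_le_one.2 hn

theorem piece_subset_closedBall (h : Φ.HasScales β m M) {C : ℝ} (hC : 0 < C)
    (hdiam : ∀ n ω, ediam (Φ.piece n ω) ≤ ENNReal.ofReal (C * M n)) {n : ℕ}
    {s : Set (EuclideanSpace ℝ (Fin d))} (hs : ediam s ≤ ENNReal.ofReal (M n))
    {y : EuclideanSpace ℝ (Fin d)} (hy : y ∈ s) {ω : Word Φ.I 0 n}
    (hω : ω ∈ Φ.piecesMeeting n s) : Φ.piece n ω ⊆ closedBall y ((C + 1) * M n) := by
  obtain ⟨x, hx, hxs⟩ := hω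
  intro z hz
  have hM := (h.upper.pos n).le
  have hzx : dist z x ≤ C * M n := (edist_le_ofReal (mul_nonneg hC.le hM)).1
    ((edist_le_ediam_of_mem hz hx).trans (hdiam n ω))
  have hxy : dist x y ≤ M n := (edist_le_ofReal hM).1 ((edist_le_ediam_of_mem hxs hy).trans hs)
  rw [mem_closedBall, add_mul, one_mul]
  exact (dist_triangle z x y).trans (add_le_add hzx hxy)

theorem ncard_piecesMeeting_mul_le [∀ n, Finite (Φ.I n)] (h : Φ.HasScales β m M) {C : ℝ}
    (hC : 0 < C) (hdiam : ∀ n ω, ediam (Φ.piece n ω) ≤ ENNReal.ofReal (C * M n)) {n : ℕ}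
    {s : Set (EuclideanSpace ℝ (Fin d))} (hs : ediam s ≤ ENNReal.ofReal (M n)) :
    (Φ.piecesMeeting n s).ncard * (ENNReal.ofReal (m n ^ d) * volume (interior X)) ≤
      ENNReal.ofReal (((C + 1) * M n) ^ d) *
        volume (ball (0 : EuclideanSpace ℝ (Fin d)) 1) := by
  rcases s.eq_empty_or_nonempty with rfl | ⟨y, hy⟩
  · simp [piecesMeeting]
  have hM := h.upper.pos n
  have hconf : ∀ ω, ∀ x ∈ interior X, ConformalAt (wordMap Φ.map 0 n ω) x := fun ω x hx =>
    Φ.conformalAt_wordMap 0 n ω (Φ.interior_subset_V hx)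
  have hinj : ∀ ω, InjOn (wordMap Φ.map 0 n ω) (interior X) := fun ω =>
    (Φ.injOn_wordMap 0 n ω).mono Φ.interior_subset_V
  have hmeas : ∀ ω, MeasurableSet (wordMap Φ.map 0 n ω '' interior X) := fun ω =>
    isOpen_interior.measurableSet.image_of_continuousOn_injOn
      ((Φ.continuousOn_wordMap 0 n ω).mono Φ.interior_subset_V) (hinj ω)
  have hvol : ∀ ω, ENNReal.ofReal (m n ^ d) * volume (interior X) ≤
      volume (wordMap Φ.map 0 n ω '' interior X) := fun ω => by
    simpa only [finrank_euclideanSpace_fin] using ofReal_pow_mul_measure_le_measure_image volume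
      isOpen_interior.measurableSet (hinj ω) (hconf ω) (h.lower.pos n).le
      fun x hx => (h.norm_fderiv_mem_Icc n ω x (Φ.interior_subset_V hx)).1
  refine (ncard_mul_le_measure_of_pairwiseDisjoint (B := closedBall y ((C + 1) * M n))
    (toFinite _) (fun ω _ ω' _ hne => Φ.disjoint_wordMap_image_interior 0 n hne)
    (fun ω _ => hmeas ω) (fun ω hω => (image_mono interior_subset).trans
      (h.piece_subset_closedBall hC hdiam hs hy hω)) fun ω _ => hvol ω).trans_eq ?_
  rw [Measure.addHaar_closedBall volume y (by positivity), finrank_euclideanSpace_fin]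

theorem exists_ncard_piecesMeeting_le [∀ n, Finite (Φ.I n)] (h : Φ.HasScales β m M)
    (hX : IsCompact X) (hint : (interior X).Nonempty) :
    ∃ Q : ℝ, 0 < Q ∧ ∀ n s, ediam s ≤ ENNReal.ofReal (M n) →
      ((Φ.piecesMeeting n s).ncard : ℝ) ≤ Q * (M n / m n) ^ d := by
  obtain ⟨C, hC, hdiam⟩ := h.exists_ediam_piece_le hX
  set v := volume.real (interior X)
  set w := volume.real (ball (0 : EuclideanSpace ℝ (Fin d)) 1)
  have hXfin : volume (interior X) ≠ ∞ :=
    ((measure_mono interior_subset).trans_lt hX.measure_lt_top).ne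
  have hv : 0 < v := ENNReal.toReal_pos (isOpen_interior.measure_pos volume hint).ne' hXfin
  have hw : 0 < w := ENNReal.toReal_pos (measure_ball_pos volume _ one_pos).ne'
    measure_ball_lt_top.ne
  refine ⟨(C + 1) ^ d * w / v, by positivity, fun n s hs => ?_⟩
  have hM := h.upper.pos n
  have hm := h.lower.pos n
  have hvol : (Φ.piecesMeeting n s).ncard * (m n ^ d * v) ≤ ((C + 1) * M n) ^ d * w := by
    have hle := ENNReal.toReal_mono (ENNReal.mul_ne_top ENNReal.ofReal_ne_top
      measure_ball_lt_top.ne) (h.ncard_piecesMeeting_mul_le hC hdiam hs)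
    simpa only [ENNReal.toReal_mul, ENNReal.toReal_natCast, ENNReal.toReal_ofReal (pow_pos hm d).le,
      ENNReal.toReal_ofReal (show 0 ≤ ((C + 1) * M n) ^ d by positivity), v, w, measureReal_def]
      using hle
  calc ((Φ.piecesMeeting n s).ncard : ℝ) ≤ ((C + 1) * M n) ^ d * w / (m n ^ d * v) :=
        (le_div_iff₀ (by positivity)).2 hvol
    _ = (C + 1) ^ d * w / v * (M n / m n) ^ d := by rw [mul_pow, div_pow]; field_simp

end HasScales

theorem HasScales.measurable_of_forall_mem_piece [∀ n, Finite (Φ.I n)]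
    [∀ k, MeasurableSpace (Φ.I k)] [∀ k, MeasurableSingletonClass (Φ.I k)]
    (h : Φ.HasScales β m M) (hX : IsCompact X) (hβ : 0 < β)
    {p : (∀ k, Φ.I (0 + k)) → EuclideanSpace ℝ (Fin d)}
    (hp : ∀ w n, p w ∈ Φ.piece n fun k => w k) : Measurable p := by
  obtain ⟨C, -, hdiam⟩ := h.exists_ediam_piece_le hX
  obtain ⟨x, hx, -⟩ := hp (fun _ => Classical.arbitrary _) 0
  refine measurable_of_tendsto_metrizable
    (f := fun (n : ℕ) w => wordMap Φ.map 0 n (fun k => w k) x) (fun n => ?_)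
    (tendsto_pi_nhds.2 fun w => tendsto_iff_edist_tendsto_0.2 ?_)
  · exact (measurable_of_finite fun ω : Word Φ.I 0 n => wordMap Φ.map 0 n ω x).comp (by fun_prop)
  · exact tendsto_of_tendsto_of_tendsto_of_le_of_le tendsto_const_nhds
      (h.tendsto_ofReal_mul_zero hβ C) (fun _ => zero_le)
      fun n => (edist_le_ediam_of_mem (s := Φ.piece n fun k => w k)
        ⟨x, hx, rfl⟩ (hp w n)).trans (hdiam n _)

/-- The measure is the image of the uniform Bernoulli measure under the coding map. -/
theorem HasScales.exists_measure_le_ncard_piecesMeeting_div [∀ n, Finite (Φ.I n)]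
    (h : Φ.HasScales β m M) (hX : IsCompact X) (hne : X.Nonempty) (hβ : 0 < β) :
    ∃ ν : Measure (EuclideanSpace ℝ (Fin d)), ν Φ.limitSet = 1 ∧ ∀ n s, IsClosed s →
      ν s ≤ (Φ.piecesMeeting n s).ncard / Nat.card (Word Φ.I 0 n) := by
  let _ : ∀ k, MeasurableSpace (Φ.I k) := fun _ => ⊤
  have : ∀ k, MeasurableSingletonClass (Φ.I k) := fun _ => ⟨fun _ => trivial⟩
  choose p hp using Φ.exists_forall_mem_piece hX hne
  have hmeas : Measurable p := h.measurable_of_forall_mem_piece hX hβ hp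
  refine ⟨(Measure.infinitePi fun k => uniformOn (univ : Set (Φ.I (0 + k)))).map p, ?_,
    fun n s hs => ?_⟩
  · have hpre : p ⁻¹' Φ.limitSet = univ := eq_univ_of_forall fun w =>
      mem_iInter₂.2 fun n _ => mem_iUnion.2 ⟨fun k => w k, hp w n⟩
    rw [Measure.map_apply hmeas (Φ.isClosed_limitSet hX).measurableSet, hpre, measure_univ]
  · rw [Measure.map_apply hmeas hs.measurableSet, ← infinitePi_uniformOn_univ_preimage
      (Ω := fun k => Φ.I (0 + k)) Fin.val_injective]
    exact measure_mono fun w hw => ⟨p w, hp w n, hw⟩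

theorem HasScales.le_dimH_limitSet [∀ n, Finite (Φ.I n)] (h : Φ.HasScales β m M)
    (hW : HasQuadraticRate (fun n => (Nat.card (Word Φ.I 0 n) : ℝ)) α) (hX : IsCompact X)
    (hint : (interior X).Nonempty) (hβ : 0 < β) :
    ENNReal.ofReal (α / β) ≤ dimH Φ.limitSet := by
  obtain ⟨Q, hQ, hcard⟩ := h.exists_ncard_piecesMeeting_le hX hint
  obtain ⟨ν, hν1, hν⟩ := h.exists_measure_le_ncard_piecesMeeting_div hX
    (hint.mono interior_subset) hβ
  refine ENNReal.le_of_forall_nnreal_lt fun t ht => ?_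
  have hrate : ∀ᶠ n in atTop,
      Q * (M n / m n) ^ d / Nat.card (Word Φ.I 0 n) ≤ M (n + 1) ^ (t : ℝ) :=
    (((HasQuadraticRate.const hQ).mul ((h.upper.div h.lower).pow d)).div hW).eventually_le
      (h.upper.succ.rpow t) (by linarith [mul_lt_of_lt_ofReal_div hβ ht])
  have hle : ν ≤ μH[t] := by
    refine le_hausdorffMeasure_of_eventually_le (r := fun n => ENNReal.ofReal (M n)) t.2
      (fun n => (ENNReal.ofReal_pos.2 (h.upper.pos n)).ne')
      (by simpa only [one_mul] using h.tendsto_ofReal_mul_zero hβ 1) ?_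
    filter_upwards [hrate] with n hn s hs
    have hW0 := hW.pos n
    calc ν s ≤ ν (closure s) := measure_mono subset_closure
      _ ≤ (Φ.piecesMeeting n (closure s)).ncard / Nat.card (Word Φ.I 0 n) :=
          hν n _ isClosed_closure
      _ = ENNReal.ofReal ((Φ.piecesMeeting n (closure s)).ncard / Nat.card (Word Φ.I 0 n)) := by
          rw [ENNReal.ofReal_div_of_pos hW0, ENNReal.ofReal_natCast, ENNReal.ofReal_natCast]
      _ ≤ ENNReal.ofReal (M (n + 1) ^ (t : ℝ)) := by
          refine ENNReal.ofReal_le_ofReal (le_trans ?_ hn)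
          gcongr
          exact hcard n _ ((ediam_closure s).trans_le hs)
      _ = ENNReal.ofReal (M (n + 1)) ^ (t : ℝ) :=
          (ENNReal.ofReal_rpow_of_pos (h.upper.pos _)).symm
  refine le_dimH_of_hausdorffMeasure_ne_zero (ne_of_gt ?_)
  calc 0 < ν Φ.limitSet := hν1 ▸ one_pos
    _ ≤ μH[t] Φ.limitSet := hle _

end NCIFS

end NonautonomousIFS

theorem proposition1p3_general {d : ℕ} (hd : 1 ≤ d) {X : Set (EuclideanSpace ℝ (Fin d))}
    (hX : IsCompact X) (hint : (interior X).Nonempty) (Φ : NCIFS.{u} X)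
    (hfin : ∀ n, Finite (Φ.I n)) (a b : ℝ) (hb : 0 < b)
    (hlim_a : Tendsto (fun n : ℕ => 1 / ((n : ℝ) + 1) * Real.log (Nat.card (Φ.I n)))
      atTop (𝓝 a))
    (hlim_b : ∀ ε : ℝ, 0 < ε → ∃ N : ℕ, ∀ n, N ≤ n → ∀ j : Φ.I n,
      |1 / ((n : ℝ) + 1) * Real.log (1 / derivNorm X (Φ.map n j)) - b| < ε) :
    Φ.bowenDim = ENNReal.ofReal (a / b) ∧ dimH Φ.limitSet = ENNReal.ofReal (a / b) := by
  have : NeZero d := ⟨(one_pos.trans_le hd).ne'⟩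
  have hne : X.Nonempty := hint.mono interior_subset
  have hlog : ∀ r : ∀ n, Φ.I n, Tendsto
      (fun n : ℕ => Real.log (derivNorm X (Φ.map n (r n))) / ((n : ℝ) + 1)) atTop (𝓝 (-b)) := by
    intro r
    have hlim : Tendsto (fun n : ℕ => 1 / ((n : ℝ) + 1) *
        Real.log (1 / derivNorm X (Φ.map n (r n)))) atTop (𝓝 b) :=
      Metric.tendsto_atTop.2 fun ε hε => (hlim_b ε hε).imp fun N hN n hn => hN n hn (r n)
    refine hlim.neg.congr fun n => ?_
    rw [one_div (derivNorm _ _), Real.log_inv, one_div_mul_eq_div, neg_div, neg_neg]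
  obtain ⟨m, M, h⟩ := Φ.exists_hasScales hne hlog
  have hW := Φ.hasQuadraticRate_card_word (hlim_a.congr fun n => one_div_mul_eq_div _ _)
  rw [← div_div_div_cancel_right₀ two_ne_zero a b]
  exact ⟨h.bowenDim_eq hW hne (half_pos hb),
    (h.dimH_limitSet_le hW hX (half_pos hb)).antisymm (h.le_dimH_limitSet hW hX hint (half_pos hb))⟩

theorem proposition1p3 {d : ℕ} (hd : 1 ≤ d) {X : Set (EuclideanSpace ℝ (Fin d))}
    (hX : IsPhaseSpace X) (Φ : NCIFS.{u} X) (hfin : ∀ n, Finite (Φ.I n))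
    (a b : ℝ) (ha : 0 < a) (hb : 0 < b)
    (hlim_a : Tendsto (fun n : ℕ => 1 / ((n : ℝ) + 1) * Real.log (Nat.card (Φ.I n)))
      atTop (𝓝 a))
    (hlim_b : ∀ ε : ℝ, 0 < ε → ∃ N : ℕ, ∀ n, N ≤ n → ∀ j : Φ.I n,
      |1 / ((n : ℝ) + 1) * Real.log (1 / derivNorm X (Φ.map n j)) - b| < ε) :
    Φ.bowenDim = ENNReal.ofReal (a / b) ∧ dimH Φ.limitSet = ENNReal.ofReal (a / b) :=
  proposition1p3_general hd hX.isCompact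
    (closure_nonempty_iff.1 (hX.closure_interior.symm ▸ hX.nonempty)) Φ hfin a b hb hlim_a hlim_b
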